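/- Let $\mathbb{K}$ be a field (finite or infinite) and write $\#\mathbb{K}$ for its cardinality. All vector spaces are finite-dimensional over $\mathbb{K}$. Definitions. Let $\mathcal{S}$ be a linear subspace of $\mathcal{L}(U,V)$, the space of linear maps from $U$ to $V$. It is reduced if $\bigcap_{f\in\mathcal{S}}\operatorname{Ker} f=\{0\}$ and $\sum_{f\in\mathcal{S}}\operatorname{Im} f=V$; it is defective if no $f\in\mathcal{S}$ is injective; it is locally linearly dependent (LLD) if every $x\in U$ is annihilated by some non-zero $f\in\mathcal{S}$; and it is minimal LLD if it is minimal, for inclusion, among the LLD linear subspaces of $\mathcal{L}(U,V)$. Its upper-rank is $\operatorname{urk}\mathcal{S}=\max_{f\in\mathcal{S}}\operatorname{rk} f$, and its transitive rank is $\operatorname{trk}\mathcal{S}=\max_{x\in U}\dim\{f(x)\mid f\in\mathcal{S}\}$. These notions apply to linear subspaces of the space $\mathrm{M}_{m,n}(\mathbb{K})$ of $m\times n$ matrices by identifying $\mathrm{M}_{m,n}(\mathbb{K})$ with $\mathcal{L}(\mathbb{K}^n,\mathbb{K}^m)$. A linear subspace $\mathcal{S}$ of $\mathrm{M}_{m,n}(\mathbb{K})$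 has the column property if, for all integers $0\le p\le m$ and $1\le s\le n$ and all $P\in\mathrm{GL}_m(\mathbb{K})$, $Q\in\mathrm{GL}_n(\mathbb{K})$ such that every matrix of $\mathcal{S}'=P\mathcal{S}Q$ has the form $$M=\begin{bmatrix} A(M) & C(M)\\ B(M) & 0\end{bmatrix},\qquad B(M)\in \mathrm{M}_{m-p,s}(\mathbb{K}),\quad C(M)\in \mathrm{M}_{p,n-s}(\mathbb{K}),$$ the space $\{B(M)\mid M\in\mathcal{S}'\}\subset \mathrm{M}_{m-p,s}(\mathbb{K})$ is defective. Statement. (1) Let $\mathcal{S}$ be a reduced linear subspace of $\mathrm{M}_{m,n}(\mathbb{K})$ with the column property. Set $r=\operatorname{urk}\mathcal{S}$ and assume that $\#\mathbb{K}>r$. Then $\operatorname{trk}\mathcal{S}\le\binom{r}{2}+1$. (2) Let $\mathcal{S}\subset\mathcal{L}(U,V)$ be a minimal LLD operator space of dimension $n$, and assume that $\#\mathbb{K}\ge n$. Then $\operatorname{rk} f\le 1+\binom{n-1}{2}$ for all $f\in\mathcal{S}$. -/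

import Mathlib

namespace LLD

section Operators

variable {K U V : Type*} [Field K] [AddCommGroup U] [Module K U] [AddCommGroup V] [Module K V]

/-- The kernel of an operator space: the common zeros of its elements. -/
def commonKernel (S : Submodule K (U →ₗ[K] V)) : Submodule K U :=
  ⨅ f ∈ S, LinearMap.ker f

/-- The essential range of an operator space: the sum of the ranges of its elements. -/
def essentialRange (S : Submodule K (U →ₗ[K] V)) : Submodule K V :=
  ⨆ f ∈ S, LinearMap.range f

/-- An operator space is reduced when its kernel is zero and its essential range is everything. -/
def IsReduced (S : Submodule K (U →ₗ[K] V)) : Prop :=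
  commonKernel S = ⊥ ∧ essentialRange S = ⊤

/-- An operator space is defective when none of its elements is injective. -/
def IsDefective (S : Submodule K (U →ₗ[K] V)) : Prop :=
  ∀ f ∈ S, ¬ Function.Injective f

/-- Local linear dependence: every vector is annihilated by some non-zero element. -/
def IsLLD (S : Submodule K (U →ₗ[K] V)) : Prop :=
  ∀ x : U, ∃ f ∈ S, f ≠ 0 ∧ f x = 0

/-- The upper-rank: the maximal rank of an element (for finite-dimensional `V`, the supremum
is a maximum, see `exists_finrank_range_eq_upperRank`). -/
noncomputable def upperRank (S : Submodule K (U →ₗ[K] V)) : ℕ :=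
  ⨆ f : S, Module.finrank K (LinearMap.range (f : U →ₗ[K] V))

/-- The space `S x` of all `f x` with `f` in `S`. -/
def orbit (S : Submodule K (U →ₗ[K] V)) (x : U) : Submodule K V :=
  S.map (LinearMap.applyₗ x)

/-- The transitive rank: the maximal dimension of `S x` (for finite-dimensional `V`, the supremum
is a maximum, see `exists_finrank_orbit_eq_transitiveRank`). -/
noncomputable def transitiveRank (S : Submodule K (U →ₗ[K] V)) : ℕ :=
  ⨆ x : U, Module.finrank K (orbit S x)

theorem mem_orbit (S : Submodule K (U →ₗ[K] V)) (x : U) (y : V) :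
    y ∈ orbit S x ↔ ∃ f ∈ S, f x = y := by
  simp [orbit]

variable [FiniteDimensional K V]

theorem exists_finrank_range_eq_upperRank (S : Submodule K (U →ₗ[K] V)) :
    (∃ f ∈ S, Module.finrank K (LinearMap.range f) = upperRank S) ∧
      ∀ f ∈ S, Module.finrank K (LinearMap.range f) ≤ upperRank S := by
  have hb : BddAbove (Set.range fun f : S =>
      Module.finrank K (LinearMap.range (f : U →ₗ[K] V))) :=
    ⟨Module.finrank K V, by rintro _ ⟨f, rfl⟩; exact Submodule.finrank_le _⟩
  refine ⟨?_, fun f hf => le_ciSup hb ⟨f, hf⟩⟩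
  obtain ⟨f, hf⟩ := Nat.sSup_mem (Set.range_nonempty _) hb
  exact ⟨f, f.2, hf⟩

theorem exists_finrank_orbit_eq_transitiveRank (S : Submodule K (U →ₗ[K] V)) :
    (∃ x, Module.finrank K (orbit S x) = transitiveRank S) ∧
      ∀ x, Module.finrank K (orbit S x) ≤ transitiveRank S := by
  have hb : BddAbove (Set.range fun x : U => Module.finrank K (orbit S x)) :=
    ⟨Module.finrank K V, by rintro _ ⟨f, rfl⟩; exact Submodule.finrank_le _⟩
  refine ⟨?_, fun x => le_ciSup hb x⟩
  obtain ⟨x, hx⟩ := Nat.sSup_mem (Set.range_nonempty _) hb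
  exact ⟨x, hx⟩

end Operators

section Matrices

variable {K : Type*} [Field K] {m n : ℕ}

/-- The operator space attached to a matrix space, where an `m × n` matrix is identified with
the linear map `X ↦ M X` from `K ^ n` to `K ^ m`. -/
noncomputable def toOperatorSpace (S : Submodule K (Matrix (Fin m) (Fin n) K)) :
    Submodule K ((Fin n → K) →ₗ[K] (Fin m → K)) :=
  S.map (Matrix.toLin' (R := K) (m := Fin m) (n := Fin n)).toLinearMap

/-- Equivalence of matrix spaces: `S = P S' Q` for some invertible `P` and `Q`. -/
def Equivalent (S S' : Submodule K (Matrix (Fin m) (Fin n) K)) : Prop :=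
  ∃ (P : GL (Fin m) K) (Q : GL (Fin n) K),
    (S : Set (Matrix (Fin m) (Fin n) K)) =
      (fun M : Matrix (Fin m) (Fin n) K =>
        (P : Matrix (Fin m) (Fin m) K) * M * (Q : Matrix (Fin n) (Fin n) K)) '' S'

/-- `S` is `(r, s)`-decomposed when the block formed by the last `m - r` rows and the last `n - s`
columns vanishes in all its elements. -/
def IsDecomposed (r s : ℕ) (S : Submodule K (Matrix (Fin m) (Fin n) K)) : Prop :=
  ∀ M ∈ S, ∀ (i : Fin m) (j : Fin n), r ≤ (i : ℕ) → s ≤ (j : ℕ) → M i j = 0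

/-- The linear map taking a matrix to its block formed by the last `m - r` rows and the first `s`
columns. -/
def lowerBlock (r s : ℕ) (hs : s ≤ n) :
    Matrix (Fin m) (Fin n) K →ₗ[K] Matrix (Fin (m - r)) (Fin s) K where
  toFun M := M.submatrix (fun i => ⟨r + i, by omega⟩) (Fin.castLE hs)
  map_add' _ _ := rfl
  map_smul' _ _ := rfl

/-- The lower space of an `(r, s)`-decomposed space. -/
def lowerSpace (r s : ℕ) (hs : s ≤ n) (S : Submodule K (Matrix (Fin m) (Fin n) K)) :
    Submodule K (Matrix (Fin (m - r)) (Fin s) K) :=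
  S.map (lowerBlock r s hs)

/-- The column property: for all `0 ≤ r ≤ m` and `1 ≤ s ≤ n`, every `(r, s)`-decomposed matrix
space equivalent to `S` has a defective lower space. -/
def ColumnProperty (S : Submodule K (Matrix (Fin m) (Fin n) K)) : Prop :=
  ∀ (r s : ℕ) (_ : r ≤ m) (_ : 1 ≤ s) (hs : s ≤ n) (S' : Submodule K (Matrix (Fin m) (Fin n) K)),
    Equivalent S' S → IsDecomposed r s S' → IsDefective (toOperatorSpace (lowerSpace r s hs S'))

end Matrices

end LLD

/-! Both parts follow from one bound, proved for operator spaces with a coordinate-free column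
property that survives quotients of V. Fix x and induct on a bound r for the ranks in S, taking J in
S of rank r. Since J + t f never has rank above r, a chain J k = 0, f k = J u, f u = J v, ... keeps
all the values of f on it inside range J (`chain_mem_range`). In particular every f maps ker J into
range J, so J x = 0 puts S x inside range J.

If J x ≠ 0, the column property at ker J says that modulo any W containing all the f(ker J), ranks
are at most r - 1. When these images span at most r - 1 dimensions, induction gives C(r-1,2) + 1 +
(r-1) = C(r,2) + 1. When all ranks modulo range J are at most r - 2, induction modulo range J
suffices. Otherwise some g has rank r - 1 modulo range J and the images fill range J. A generic
combination with g then shows that every restriction to ker J has rank at most 1, and the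
classification of such spaces yields k in ker J with range J inside S k. There the chain relations
bound S x directly.

Part (2) is dual: in the space of evaluations f ↦ f x on S, the orbit of f is the range of f. LLD
bounds the ranks by n - 1, and minimality gives the column property. -/

namespace LLD

/-! ### Rank conditions on pencils of operators -/

section Rank

open Polynomial

variable {K : Type*} [Field K] {E F G H : Type*} [AddCommGroup E] [Module K E]
  [AddCommGroup F] [Module K F] [AddCommGroup G] [Module K G] [AddCommGroup H] [Module K H]

/-- The determinant of a family of vectors, read through a linear map to coordinate space. -/
noncomputable def coordDet {a : ℕ} (L : F →ₗ[K] (Fin a → K)) (v : Fin a → F) : K :=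
  (Matrix.of fun i j => L (v j) i).det

theorem linearIndependent_of_coordDet_ne_zero {a : ℕ} {L : F →ₗ[K] (Fin a → K)} {v : Fin a → F}
    (h : coordDet L v ≠ 0) : LinearIndependent K v :=
  LinearIndependent.of_comp L (Matrix.linearIndependent_cols_of_det_ne_zero h)

theorem exists_coordDet_ne_zero {a : ℕ} {v : Fin a → F} (h : LinearIndependent K v) :
    ∃ L : F →ₗ[K] (Fin a → K), coordDet L v ≠ 0 := by
  obtain ⟨L, hL⟩ := LinearMap.exists_leftInverse_of_injective (Fintype.linearCombination K v)
    (LinearMap.ker_eq_bot.2 h.fintypeLinearCombination_injective)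
  refine ⟨L, ?_⟩
  have h1 : ∀ j, L (v j) = Pi.single j 1 := fun j => by
    have := LinearMap.congr_fun hL (Pi.single j 1)
    simpa [Fintype.linearCombination_apply_single] using this
  have h2 : (Matrix.of fun i j => L (v j) i) = (1 : Matrix (Fin a) (Fin a) K) := by
    ext i j
    simp [h1, Matrix.one_apply, Pi.single_apply]
  simp [coordDet, h2]

theorem le_finrank_of_forall_mem [FiniteDimensional K F] {a : ℕ} {v : Fin a → F}
    (h : LinearIndependent K v) {W : Submodule K F} (hv : ∀ i, v i ∈ W) :
    a ≤ Module.finrank K W := by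
  have h1 : LinearIndependent K (fun i => (⟨v i, hv i⟩ : W)) :=
    LinearIndependent.of_comp W.subtype h
  simpa using h1.fintype_card_le_finrank

theorem exists_linearIndependent_apply {a : ℕ} {f : E →ₗ[K] F}
    (h : a ≤ Module.finrank K (LinearMap.range f)) :
    ∃ e : Fin a → E, LinearIndependent K (fun i => f (e i)) := by
  obtain ⟨v, hv⟩ := exists_linearIndependent_of_le_finrank h
  choose e he using fun i => (v i).2
  refine ⟨e, ?_⟩
  simp only [he]
  exact hv.map' (LinearMap.range f).subtype (Submodule.ker_subtype _)

/-- The coefficient of degree a is the value of the pencil at infinity, recorded so that this point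
can be used too. -/
theorem exists_coordDet_polynomial {a : ℕ} (L : F →ₗ[K] (Fin a → K)) (v w : Fin a → F) :
    ∃ p : K[X], p.natDegree ≤ a ∧ p.coeff 0 = coordDet L v ∧ p.coeff a = coordDet L w ∧
      ∀ t, p.eval t = coordDet L (v + t • w) := by
  refine ⟨(X • (Matrix.of fun i j => L (w j) i).map C + (Matrix.of fun i j => L (v j) i).map C).det,
    ?_, coeff_det_X_add_C_zero _ _, ?_, fun t => ?_⟩
  · simpa using natDegree_det_X_add_C_le (Matrix.of fun i j => L (w j) i)
      (Matrix.of fun i j => L (v j) i)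
  · simpa [coordDet] using coeff_det_X_add_C_card (Matrix.of fun i j => L (w j) i)
      (Matrix.of fun i j => L (v j) i)
  · rw [← coe_evalRingHom, RingHom.map_det, coordDet]
    congr 1
    ext i j
    simp only [coe_evalRingHom, RingHom.mapMatrix_apply, Matrix.map_apply, Matrix.add_apply,
      Matrix.smul_apply, Matrix.of_apply, smul_eq_mul, eval_mul, eval_X, eval_C,
      Pi.add_apply, Pi.smul_apply, map_add, map_smul]
    exact add_comm _ _

/-- The two rank conditions are non-vanishing conditions on binary forms of degrees a and b. Their
product has at most a + b zeros on the projective line, which has #K + 1 points: either infinity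
works, or the degree drops below a + b. -/
theorem exists_combination_of_le_finrank [FiniteDimensional K F] [FiniteDimensional K H] {a b : ℕ}
    {f f' : E →ₗ[K] F} {g g' : G →ₗ[K] H} (hf : a ≤ Module.finrank K (LinearMap.range f))
    (hg : b ≤ Module.finrank K (LinearMap.range g')) (hK : ((a + b : ℕ) : Cardinal) ≤ Cardinal.mk K) :
    ∃ s t : K, a ≤ Module.finrank K (LinearMap.range (s • f + t • f')) ∧
      b ≤ Module.finrank K (LinearMap.range (s • g + t • g')) := by
  obtain ⟨e, he⟩ := exists_linearIndependent_apply hf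
  obtain ⟨d, hd⟩ := exists_linearIndependent_apply hg
  obtain ⟨L, hL⟩ := exists_coordDet_ne_zero he
  obtain ⟨M, hM⟩ := exists_coordDet_ne_zero hd
  obtain ⟨p, hp, hp0, hpa, hpe⟩ := exists_coordDet_polynomial L (fun i => f (e i)) (fun i => f' (e i))
  obtain ⟨q, hq, hq0, hqb, hqe⟩ := exists_coordDet_polynomial M (fun i => g (d i)) (fun i => g' (d i))
  by_cases hc : p.coeff a = 0
  · have hp' : p ≠ 0 := by rintro rfl; exact hL (by simpa using hp0.symm)
    have hq' : q ≠ 0 := by rintro rfl; exact hM (by simpa using hqb.symm)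
    have hlt : p.natDegree < a := lt_of_le_of_ne hp fun h => hp' <| by
      rwa [← h, coeff_natDegree, leadingCoeff_eq_zero] at hc
    have hdeg : (p * q).natDegree < a + b := by
      have := natDegree_mul_le (p := p) (q := q)
      omega
    obtain ⟨t, ht⟩ := exists_eval_ne_zero_of_natDegree_lt_card (p * q) (mul_ne_zero hp' hq')
      ((Nat.cast_lt.2 hdeg).trans_le hK)
    rw [eval_mul, hpe, hqe] at ht
    refine ⟨1, t, le_finrank_of_forall_mem (linearIndependent_of_coordDet_ne_zero
      (left_ne_zero_of_mul ht)) fun i => ⟨e i, by simp⟩, le_finrank_of_forall_mem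
      (linearIndependent_of_coordDet_ne_zero (right_ne_zero_of_mul ht)) fun i => ⟨d i, by simp⟩⟩
  · rw [hpa] at hc
    refine ⟨0, 1, le_finrank_of_forall_mem (linearIndependent_of_coordDet_ne_zero hc)
      fun i => ⟨e i, by simp⟩, le_finrank_of_forall_mem hd fun i => ⟨d i, by simp⟩⟩

/-- If y is outside range J, the minor p(t) of (y, (J + t f) e₁, ..., (J + t f) eᵣ) is non-zero at t
= 0. A non-zero value at some t ≠ 0 would give J + t f rank r + 1. -/
theorem mem_range_of_forall_mem_range_add_smul [FiniteDimensional K F] {r : ℕ} {J f : E →ₗ[K] F}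
    (hJ : Module.finrank K (LinearMap.range J) = r)
    (hf : Module.finrank K (LinearMap.range f) ≤ r)
    (hJf : ∀ t : K, Module.finrank K (LinearMap.range (J + t • f)) ≤ r)
    (hK : (r : Cardinal) < Cardinal.mk K) {y : F} (hy : y ∈ LinearMap.range f)
    (hyt : ∀ t : K, t ≠ 0 → y ∈ LinearMap.range (J + t • f)) : y ∈ LinearMap.range J := by
  by_contra hyJ
  obtain ⟨e, he⟩ := exists_linearIndependent_apply hJ.ge
  have hli : LinearIndependent K (Fin.cons y fun i => J (e i) : Fin (r + 1) → F) := by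
    refine linearIndependent_finCons.2 ⟨he, fun h => hyJ ?_⟩
    exact Submodule.span_le.2 (Set.range_subset_iff.2 fun i => LinearMap.mem_range_self J (e i)) h
  obtain ⟨L, hL⟩ := exists_coordDet_ne_zero hli
  let A : Matrix (Fin (r + 1)) (Fin (r + 1)) K :=
    .of fun i j => L ((Fin.cons y fun i => f (e i) : Fin (r + 1) → F) j) i
  let A₀ : Matrix (Fin (r + 1)) (Fin (r + 1)) K :=
    .of fun i j => L ((Fin.cons 0 fun i => f (e i) : Fin (r + 1) → F) j) i
  let B : Matrix (Fin (r + 1)) (Fin (r + 1)) K :=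
    .of fun i j => L ((Fin.cons y fun i => J (e i) : Fin (r + 1) → F) j) i
  let B₀ : Matrix (Fin (r + 1)) (Fin (r + 1)) K :=
    .of fun i j => L ((Fin.cons 0 fun i => J (e i) : Fin (r + 1) → F) j) i
  have hA : A.det = 0 := by
    by_contra h
    have := le_finrank_of_forall_mem (W := LinearMap.range f)
      (linearIndependent_of_coordDet_ne_zero (L := L) h) (Fin.cases hy fun i => LinearMap.mem_range_self f (e i))
    omega
  set p : K[X] := ((X : K[X]) • A₀.map C + B.map C).det with hp
  -- The factor X will force t ≠ 0. Absorbed into the first column, it makes det A = 0 the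
  -- coefficient of degree r + 1, so the degree is at most r and #K > r suffices.
  have hXp : X * p = ((X : K[X]) • A.map C + B₀.map C).det := by
    have := Matrix.det_mul_row (Fin.cons X fun _ => 1 : Fin (r + 1) → K[X])
      ((X : K[X]) • A₀.map C + B.map C)
    rw [Fin.prod_univ_succ] at this
    simp only [Fin.cons_zero, Fin.cons_succ, Finset.prod_const_one, mul_one] at this
    rw [hp, ← this]
    congr 1
    ext1 i j
    refine Fin.cases ?_ (fun j => ?_) j <;> simp [A, A₀, B, B₀]
  have hp0 : p.coeff 0 ≠ 0 := by
    rw [hp, coeff_det_X_add_C_zero]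
    exact hL
  have hp' : p ≠ 0 := by
    intro h
    simp [h] at hp0
  have hdeg : (X * p).natDegree < r + 1 := by
    have h1 : (X * p).natDegree ≤ r + 1 := by
      rw [hXp]
      simpa using natDegree_det_X_add_C_le A B₀
    refine lt_of_le_of_ne h1 fun h => (mul_ne_zero X_ne_zero hp' : X * p ≠ 0) ?_
    rw [← leadingCoeff_eq_zero, leadingCoeff, h, hXp]
    simpa [hA] using coeff_det_X_add_C_card A B₀
  obtain ⟨t, ht⟩ := exists_eval_ne_zero_of_natDegree_lt_card (X * p) (mul_ne_zero X_ne_zero hp')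
    ((Nat.cast_le.2 (Nat.lt_succ_iff.1 hdeg)).trans_lt hK)
  rw [eval_mul, eval_X] at ht
  have hd : coordDet L (Fin.cons y fun i => (J + t • f) (e i) : Fin (r + 1) → F) ≠ 0 := by
    convert right_ne_zero_of_mul ht
    rw [hp, ← coe_evalRingHom, RingHom.map_det, coordDet]
    congr 1
    ext i j
    refine Fin.cases ?_ (fun j => ?_) j
    · simp [A₀, B]
    · simp [A₀, B, add_comm, mul_comm t]
  have := le_finrank_of_forall_mem (W := LinearMap.range (J + t • f))
    (linearIndependent_of_coordDet_ne_zero hd)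
    (Fin.cases (hyt t (left_ne_zero_of_mul ht)) fun i => LinearMap.mem_range_self _ (e i))
  have := hJf t
  omega

end Rank

end LLD
namespace LLD

/-! ### The column property and quotients -/

section Structure

variable {K : Type*} [Field K] {U V : Type*} [AddCommGroup U] [Module K U]
  [AddCommGroup V] [Module K V]

/-- The column property for operator spaces: whenever all the elements of `S` map `U₀ ≠ ⊤` into
`W`, none of the induced operators from `U ⧸ U₀` to `V ⧸ W` is injective. -/
def OperatorColumnProperty (S : Submodule K (U →ₗ[K] V)) : Prop :=
  ∀ (U₀ : Submodule K U) (W : Submodule K V), U₀ ≠ ⊤ → (∀ f ∈ S, ∀ u ∈ U₀, f u ∈ W) →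
    ∀ f ∈ S, ∃ u, u ∉ U₀ ∧ f u ∈ W

theorem OperatorColumnProperty.map_mkQ {S : Submodule K (U →ₗ[K] V)}
    (hS : OperatorColumnProperty S) (W : Submodule K V) :
    OperatorColumnProperty (S.map (LinearMap.compRight K W.mkQ)) := by
  rintro U₀ W' hU₀ h _ ⟨f, hf, rfl⟩
  obtain ⟨u, hu, hu'⟩ := hS U₀ (W'.comap W.mkQ) hU₀
    (fun g hg u hu => h _ (Submodule.mem_map_of_mem hg) u hu) f hf
  exact ⟨u, hu, hu'⟩

theorem OperatorColumnProperty.finrank_range_mkQ_lt [FiniteDimensional K U] {S : Submodule K (U →ₗ[K] V)}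
    (hS : OperatorColumnProperty S) {U₀ : Submodule K U} {W : Submodule K V} (hU₀ : U₀ ≠ ⊤)
    (h : ∀ f ∈ S, ∀ u ∈ U₀, f u ∈ W) {f : U →ₗ[K] V} (hf : f ∈ S) :
    Module.finrank K (LinearMap.range (W.mkQ ∘ₗ f)) + Module.finrank K U₀ <
      Module.finrank K U := by
  obtain ⟨u, hu, hu'⟩ := hS U₀ W hU₀ h f hf
  have hlt : U₀ < LinearMap.ker (W.mkQ ∘ₗ f) := by
    refine lt_of_le_of_ne (fun v hv => by simpa using h f hf v hv) ?_
    rintro rfl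
    exact hu (by simpa using hu')
  have := Submodule.finrank_lt_finrank_of_lt hlt
  have := LinearMap.finrank_range_add_finrank_ker (W.mkQ ∘ₗ f)
  omega

theorem finrank_map_mkQ_add_finrank_inf [FiniteDimensional K V] (A W : Submodule K V) :
    Module.finrank K (A.map W.mkQ) + Module.finrank K ↥(A ⊓ W) = Module.finrank K A := by
  have h1 := LinearMap.finrank_range_add_finrank_ker (W.mkQ.domRestrict A)
  have h2 : (LinearMap.ker (W.mkQ.domRestrict A)).map A.subtype = A ⊓ W := by
    ext v
    simp [and_comm]
  rwa [LinearMap.range_domRestrict, ← LinearEquiv.finrank_eq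
    (Submodule.equivMapOfInjective A.subtype A.injective_subtype _).symm, h2] at h1

theorem orbit_map_compRight (S : Submodule K (U →ₗ[K] V)) (W : Submodule K V) (x : U) :
    orbit (S.map (LinearMap.compRight K W.mkQ)) x = (orbit S x).map W.mkQ := by
  rw [orbit, orbit, ← Submodule.map_comp, ← Submodule.map_comp]
  rfl

theorem finrank_orbit_le_of_map_mkQ [FiniteDimensional K V] (S : Submodule K (U →ₗ[K] V)) (W : Submodule K V) (x : U) :
    Module.finrank K (orbit S x) ≤
      Module.finrank K (orbit (S.map (LinearMap.compRight K W.mkQ)) x) + Module.finrank K W := by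
  rw [orbit_map_compRight, ← finrank_map_mkQ_add_finrank_inf (orbit S x) W]
  exact Nat.add_le_add_left (Submodule.finrank_mono inf_le_right) _

/-! ### Chains starting in the kernel of an operator of maximal rank -/

section Chain

variable [FiniteDimensional K V] {S : Submodule K (U →ₗ[K] V)} {r : ℕ} {J f g : U →ₗ[K] V}

/-- A chain `f k = J u₁, f u₁ = J u₂, …` starting in the kernel of an operator `J` of maximal rank
never leaves the range of `J`. -/
theorem chain_mem_range (hr : ∀ f ∈ S, Module.finrank K (LinearMap.range f) ≤ r)
    (hK : (r : Cardinal) < Cardinal.mk K) (hJS : J ∈ S)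
    (hJ : Module.finrank K (LinearMap.range J) = r) (hf : f ∈ S) (c : ℕ → U) (hc0 : J (c 0) = 0)
    (n : ℕ) (hc : ∀ i < n, f (c i) = J (c (i + 1))) : f (c n) ∈ LinearMap.range J := by
  refine mem_range_of_forall_mem_range_add_smul hJ (hr f hf)
    (fun t => hr _ (S.add_mem hJS (S.smul_mem t hf))) hK (LinearMap.mem_range_self f _)
    fun t ht => ?_
  -- The weights (-t)^i make the sum telescope, leaving a non-zero multiple of f (c n) in range (J +
  -- t f) when t ≠ 0.
  have key : ∀ j ≤ n, (J + t • f) (∑ i ∈ Finset.range (j + 1), (-t) ^ i • c i) =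
      (t * (-t) ^ j) • f (c j) := by
    intro j hj
    induction j with
    | zero => simp [hc0]
    | succ j ih =>
      rw [Finset.sum_range_succ, map_add, ih (by omega), hc j (by omega)]
      simp only [map_smul, LinearMap.add_apply, LinearMap.smul_apply, smul_add, smul_smul]
      rw [← add_assoc, ← add_smul]
      have : t * (-t) ^ j + (-t) ^ (j + 1) = 0 := by ring
      rw [this, zero_smul, zero_add, mul_comm]
  have h0 : t * (-t) ^ n ≠ 0 := mul_ne_zero ht (pow_ne_zero _ (neg_ne_zero.2 ht))
  rw [← Submodule.smul_mem_iff _ h0, ← key n le_rfl]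
  exact LinearMap.mem_range_self _ _

theorem apply_mem_range_of_mem_ker (hr : ∀ f ∈ S, Module.finrank K (LinearMap.range f) ≤ r)
    (hK : (r : Cardinal) < Cardinal.mk K) (hJS : J ∈ S)
    (hJ : Module.finrank K (LinearMap.range J) = r) (hf : f ∈ S) {k : U} (hk : J k = 0) :
    f k ∈ LinearMap.range J :=
  chain_mem_range hr hK hJS hJ hf (fun _ => k) hk 0 (by simp)

theorem apply_mem_range_of_chain_one (hr : ∀ f ∈ S, Module.finrank K (LinearMap.range f) ≤ r)
    (hK : (r : Cardinal) < Cardinal.mk K) (hJS : J ∈ S)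
    (hJ : Module.finrank K (LinearMap.range J) = r) (hf : f ∈ S) {k u : U} (hk : J k = 0)
    (hku : f k = J u) : f u ∈ LinearMap.range J :=
  chain_mem_range hr hK hJS hJ hf (fun i => if i = 0 then k else u) (by simpa using hk) 1
    (by rintro i hi; obtain rfl : i = 0 := by omega
        simpa using hku)

theorem apply_mem_range_of_chain_two (hr : ∀ f ∈ S, Module.finrank K (LinearMap.range f) ≤ r)
    (hK : (r : Cardinal) < Cardinal.mk K) (hJS : J ∈ S)
    (hJ : Module.finrank K (LinearMap.range J) = r) (hf : f ∈ S) {k u v : U} (hk : J k = 0)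
    (hku : f k = J u) (huv : f u = J v) : f v ∈ LinearMap.range J :=
  chain_mem_range hr hK hJS hJ hf (fun i => if i = 0 then k else if i = 1 then u else v)
    (by simpa using hk) 2
    (by rintro i hi
        obtain rfl | rfl : i = 0 ∨ i = 1 := by omega
        · simpa using hku
        · simpa using huv)

/-- Polarization of the one-step chain relation, which is quadratic in f. -/
theorem apply_add_apply_mem_range (hr : ∀ f ∈ S, Module.finrank K (LinearMap.range f) ≤ r)
    (hK : (r : Cardinal) < Cardinal.mk K) (hJS : J ∈ S)
    (hJ : Module.finrank K (LinearMap.range J) = r) (hf : f ∈ S) (hg : g ∈ S) {k u v : U}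
    (hk : J k = 0) (hu : f k = J u) (hv : g k = J v) : f v + g u ∈ LinearMap.range J := by
  have h := apply_mem_range_of_chain_one hr hK hJS hJ (S.add_mem hf hg) hk (u := u + v)
    (by simp [hu, hv])
  have h1 := apply_mem_range_of_chain_one hr hK hJS hJ hf hk hu
  have h2 := apply_mem_range_of_chain_one hr hK hJS hJ hg hk hv
  convert Submodule.sub_mem _ (Submodule.sub_mem _ h h1) h2 using 1
  simp only [LinearMap.add_apply, map_add]
  abel

end Chain

/-! ### Spaces of operators of rank at most one -/

theorem mem_span_singleton_apply_of_finrank_range_le_one {E F : Type*} [AddCommGroup E] [Module K E]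
    [AddCommGroup F] [Module K F] [FiniteDimensional K F] {f : E →ₗ[K] F}
    (hf : Module.finrank K (LinearMap.range f) ≤ 1) {a : E} (ha : f a ≠ 0) (b : E) :
    f b ∈ Submodule.span K {f a} := by
  obtain ⟨v, hv⟩ := finrank_le_one_iff.1 hf
  obtain ⟨c, hc⟩ := hv ⟨f a, a, rfl⟩
  obtain ⟨d, hd⟩ := hv ⟨f b, b, rfl⟩
  replace hc : c • (v : F) = f a := congrArg Subtype.val hc
  replace hd : d • (v : F) = f b := congrArg Subtype.val hd
  have hc0 : c ≠ 0 := by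
    rintro rfl
    exact ha (by rw [← hc, zero_smul])
  refine Submodule.mem_span_singleton.2 ⟨d * c⁻¹, ?_⟩
  rw [← hc, ← hd, smul_smul, inv_mul_cancel_right₀ hc0]

theorem mem_span_singleton_of_mem_of_mem {F : Type*} [AddCommGroup F] [Module K F] {w y z : F}
    (hw : w ≠ 0) (hwy : w ∈ Submodule.span K {y}) (hzy : z ∈ Submodule.span K {y}) :
    z ∈ Submodule.span K {w} := by
  obtain ⟨c, rfl⟩ := Submodule.mem_span_singleton.1 hwy
  obtain ⟨d, rfl⟩ := Submodule.mem_span_singleton.1 hzy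
  refine Submodule.mem_span_singleton.2 ⟨d * c⁻¹, ?_⟩
  rw [smul_smul, inv_mul_cancel_right₀ (left_ne_zero_of_smul hw)]

/-- In a linear space of operators of rank at most one, either all the elements have their ranges in
a common line, or the range of each one is spanned by its value at a common vector. -/
theorem exists_common_line_or_common_vector {E F : Type*} [AddCommGroup E] [Module K E]
    [AddCommGroup F] [Module K F] [FiniteDimensional K F] (T : Submodule K (E →ₗ[K] F))
    (hT : ∀ f ∈ T, Module.finrank K (LinearMap.range f) ≤ 1) :
    (∃ w : F, ∀ f ∈ T, ∀ e, f e ∈ Submodule.span K {w}) ∨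
      ∃ e₀ : E, ∀ f ∈ T, ∀ e, f e ∈ Submodule.span K {f e₀} := by
  by_cases h0 : ∀ f ∈ T, ∀ e, f e = 0
  · exact .inl ⟨0, fun f hf e => by simp [h0 f hf e]⟩
  push Not at h0
  obtain ⟨f₁, hf₁, e₁, he₁⟩ := h0
  by_cases h1 : ∀ f ∈ T, ∀ e, f e ∈ Submodule.span K {f₁ e₁}
  · exact .inl ⟨_, h1⟩
  push Not at h1
  obtain ⟨f₂, hf₂, e₂, he₂⟩ := h1
  have cross : ∀ f ∈ T, ∀ g ∈ T, ∀ k, f k = 0 → g k ≠ 0 → ∀ e, f e ∈ Submodule.span K {g k} := by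
    intro f hf g hg k hfk hgk e
    have hfg : (f + g) k = g k := by simp [hfk]
    have h2 := mem_span_singleton_apply_of_finrank_range_le_one (hT _ (T.add_mem hf hg))
      (hfg ▸ hgk) e
    rw [hfg, LinearMap.add_apply] at h2
    exact (Submodule.add_mem_iff_left _
      (mem_span_singleton_apply_of_finrank_range_le_one (hT g hg) hgk e)).1 h2
  have hk₂ : ∀ k, f₁ k = 0 → f₂ k = 0 := by
    intro k hk
    by_contra hk'
    exact he₂ (mem_span_singleton_of_mem_of_mem he₁ (cross f₁ hf₁ f₂ hf₂ k hk hk' e₁)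
      (mem_span_singleton_apply_of_finrank_range_le_one (hT f₂ hf₂) hk' e₂))
  -- Otherwise `cross` puts the ranges of f₁ and f₂ in the same line. So all of T factors through
  -- the line E / ker f₁, generated by the class of e₁.
  have hk : ∀ f ∈ T, ∀ k, f₁ k = 0 → f k = 0 := by
    intro f hf k hk
    by_contra hk'
    exact he₂ (mem_span_singleton_of_mem_of_mem he₁ (cross f₁ hf₁ f hf k hk hk' e₁)
      (cross f₂ hf₂ f hf k (hk₂ k hk) hk' e₂))
  refine .inr ⟨e₁, fun f hf e => ?_⟩
  obtain ⟨c, hc⟩ := Submodule.mem_span_singleton.1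
    (mem_span_singleton_apply_of_finrank_range_le_one (hT f₁ hf₁) he₁ e)
  refine Submodule.mem_span_singleton.2 ⟨c, ?_⟩
  have := hk f hf (c • e₁ - e) (by rw [map_sub, map_smul, hc, sub_self])
  rwa [map_sub, map_smul, sub_eq_zero] at this

end Structure

end LLD
namespace LLD

section Structure

variable {K : Type*} [Field K] {U V : Type*} [AddCommGroup U] [Module K U]
  [AddCommGroup V] [Module K V]

theorem finrank_comap_of_le_range [FiniteDimensional K U] {J : U →ₗ[K] V} {N : Submodule K V}
    (hN : N ≤ LinearMap.range J) :
    Module.finrank K (N.comap J) = Module.finrank K N + Module.finrank K (LinearMap.ker J) := by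
  have h1 := LinearMap.finrank_range_add_finrank_ker (J.domRestrict (N.comap J))
  have h2 : (LinearMap.ker (J.domRestrict (N.comap J))).map (N.comap J).subtype =
      LinearMap.ker J := by
    ext v
    simp +contextual
  rw [LinearMap.range_domRestrict, Submodule.map_comap_eq_of_le hN, ← LinearEquiv.finrank_eq
    (Submodule.equivMapOfInjective _ (N.comap J).injective_subtype _).symm, h2] at h1
  exact h1.symm

theorem finrank_span_singleton_le_one (v : V) : Module.finrank K (Submodule.span K {v}) ≤ 1 := by
  have := finrank_span_finset_le_card (R := K) ({v} : Finset V)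
  rwa [Finset.coe_singleton, Finset.card_singleton] at this

theorem succ_choose_two (n : ℕ) : (n + 1).choose 2 = n.choose 2 + n := by
  rw [Nat.choose_succ_succ' n 1, Nat.choose_one_right, add_comm]

theorem le_choose_two_add_one (r : ℕ) : r ≤ r.choose 2 + 1 := by
  cases r with
  | zero => simp
  | succ n => rw [succ_choose_two]; omega

/-! ### Restrictions to the kernel, and the extremal configuration -/

section Restriction

variable [FiniteDimensional K U] [FiniteDimensional K V] {S : Submodule K (U →ₗ[K] V)} {r : ℕ}
  {J f g : U →ₗ[K] V}

/-- Otherwise some combination h has both rank at least r - 1 modulo range J and rank at least 2 on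
ker J. By one-step chains h maps J⁻¹(h(ker J)) into range J, so its rank modulo range J is at most r
- 2. -/
theorem finrank_range_domRestrict_ker_le_one
    (hr : ∀ f ∈ S, Module.finrank K (LinearMap.range f) ≤ r)
    (hK : (r : Cardinal) < Cardinal.mk K) (hJS : J ∈ S)
    (hJ : Module.finrank K (LinearMap.range J) = r) (hr2 : 2 ≤ r) (hg : g ∈ S)
    (hgr : r - 1 ≤ Module.finrank K (LinearMap.range ((LinearMap.range J).mkQ ∘ₗ g))) (hf : f ∈ S) :
    Module.finrank K (LinearMap.range (f.domRestrict (LinearMap.ker J))) ≤ 1 := by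
  by_contra hcon
  obtain ⟨s, t, hs, ht⟩ := exists_combination_of_le_finrank (a := r - 1) (b := 2)
    (f' := (LinearMap.range J).mkQ ∘ₗ f) (g := g.domRestrict (LinearMap.ker J)) hgr
    (Nat.succ_le_iff.2 (not_le.1 hcon)) <| by
      rw [show r - 1 + 2 = r + 1 by omega, Nat.cast_add_one]
      exact Cardinal.add_one_le_of_lt hK
  set h := s • g + t • f with hh
  have hhS : h ∈ S := S.add_mem (S.smul_mem s hg) (S.smul_mem t hf)
  have e1 : s • (LinearMap.range J).mkQ ∘ₗ g + t • (LinearMap.range J).mkQ ∘ₗ f =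
      (LinearMap.range J).mkQ ∘ₗ h := by
    rw [hh, LinearMap.comp_add, LinearMap.comp_smul, LinearMap.comp_smul]
  have e2 : s • g.domRestrict (LinearMap.ker J) + t • f.domRestrict (LinearMap.ker J) =
      h.domRestrict (LinearMap.ker J) := rfl
  rw [e1] at hs
  rw [e2] at ht
  have hle : LinearMap.range (h.domRestrict (LinearMap.ker J)) ≤ LinearMap.range J := by
    rintro _ ⟨k, rfl⟩
    exact apply_mem_range_of_mem_ker hr hK hJS hJ hhS k.2
  have hker : (LinearMap.range (h.domRestrict (LinearMap.ker J))).comap J ≤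
      LinearMap.ker ((LinearMap.range J).mkQ ∘ₗ h) := by
    rintro u ⟨k, hk⟩
    simpa using apply_mem_range_of_chain_one hr hK hJS hJ hhS k.2 hk
  have h1 := Submodule.finrank_mono hker
  rw [finrank_comap_of_le_range hle] at h1
  have h2 := LinearMap.finrank_range_add_finrank_ker ((LinearMap.range J).mkQ ∘ₗ h)
  have h3 := LinearMap.finrank_range_add_finrank_ker J
  omega

/-- The extremal configuration: the kernel of an operator `J` of maximal rank contains a vector
whose orbit is the whole range of `J`. -/
theorem finrank_orbit_le_of_range_le_orbit
    (hr : ∀ f ∈ S, Module.finrank K (LinearMap.range f) ≤ r)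
    (hK : (r : Cardinal) < Cardinal.mk K) (hJS : J ∈ S)
    (hJ : Module.finrank K (LinearMap.range J) = r) (hr2 : 2 ≤ r)
    (hB : ∀ f ∈ S, Module.finrank K (LinearMap.range ((LinearMap.range J).mkQ ∘ₗ f)) ≤ r - 1)
    {k : U} (hk : J k = 0) (hkS : LinearMap.range J ≤ orbit S k) {x : U} (hx : J x ≠ 0) :
    Module.finrank K (orbit S x) ≤ r.choose 2 + 1 := by
  have lift : ∀ u, ∃ g ∈ S, g k = J u := fun u => (mem_orbit S k _).1 (hkS ⟨u, rfl⟩)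
  obtain ⟨g, hg, hgk⟩ := lift x
  set W := LinearMap.range J with hW
  have hD : ∀ f ∈ S, ∀ v, J v = 0 → f v ∈ W := fun f hf v hv =>
    apply_mem_range_of_mem_ker hr hK hJS hJ hf hv
  -- With f k = J u and g k = J x, polarization gives f x ≡ -g u modulo W.
  have hmod : (orbit S x).map W.mkQ ≤ LinearMap.range (W.mkQ ∘ₗ g) := by
    rintro _ ⟨y, hy, rfl⟩
    obtain ⟨f, hf, rfl⟩ := (mem_orbit S x y).1 hy
    obtain ⟨u, hu⟩ := hD f hf k hk
    refine ⟨-u, ?_⟩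
    have := apply_add_apply_mem_range hr hK hJS hJ hf hg hk hu.symm hgk
    rw [LinearMap.comp_apply, map_neg, ← sub_eq_zero, ← map_sub, Submodule.mkQ_apply,
      Submodule.Quotient.mk_eq_zero]
    convert W.neg_mem this using 1
    abel
  have h1 := finrank_map_mkQ_add_finrank_inf (orbit S x) W
  have h2 := Submodule.finrank_mono hmod
  have h3 : Module.finrank K ↥(orbit S x ⊓ W) ≤ Module.finrank K W :=
    Submodule.finrank_mono inf_le_right
  have h4 := hB g hg
  by_cases hρ : Module.finrank K (LinearMap.range (W.mkQ ∘ₗ g)) ≤ r - 2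
  -- Here dim S x ≤ (r - 2) + r. Below, g has rank exactly r - 1 modulo W, so g⁻¹(W) is just ker J +
  -- K x, and S x ∩ W reduces to a line.
  · obtain ⟨q, rfl⟩ : ∃ q, r = q + 2 := ⟨r - 2, by omega⟩
    rw [succ_choose_two, succ_choose_two]
    omega
  have hgx : g x ∈ W := apply_mem_range_of_chain_one hr hK hJS hJ hg hk hgk
  have hgW : ∀ u, g u ∈ W → ∃ c : K, J (u - c • x) = 0 := by
    have hle : LinearMap.ker J ⊔ Submodule.span K {x} ≤ LinearMap.ker (W.mkQ ∘ₗ g) := by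
      refine sup_le (fun v hv => by simpa using hD g hg v hv) ?_
      rw [Submodule.span_singleton_le_iff_mem]
      simpa using hgx
    have hlt : LinearMap.ker J < LinearMap.ker J ⊔ Submodule.span K {x} := by
      refine lt_of_le_of_ne le_sup_left fun h => hx ?_
      rw [← LinearMap.mem_ker, h]
      exact Submodule.mem_sup_right (Submodule.mem_span_singleton_self x)
    have e1 := LinearMap.finrank_range_add_finrank_ker (W.mkQ ∘ₗ g)
    have e2 := LinearMap.finrank_range_add_finrank_ker J
    rw [← hW] at e2
    have e3 := Submodule.finrank_lt_finrank_of_lt hlt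
    have heq := Submodule.eq_of_le_of_finrank_le hle (by omega)
    intro u hu
    have hu' : u ∈ LinearMap.ker J ⊔ Submodule.span K {x} := by
      rw [heq]
      simpa using hu
    obtain ⟨v, hv, z, hz, rfl⟩ := Submodule.mem_sup.1 hu'
    obtain ⟨c, rfl⟩ := Submodule.mem_span_singleton.1 hz
    exact ⟨c, by simpa using hv⟩
  have hJspan : ∀ u, g u ∈ W → J u ∈ Submodule.span K {J x} := by
    intro u hu
    obtain ⟨c, hc⟩ := hgW u hu
    rw [map_sub, map_smul, sub_eq_zero] at hc
    exact Submodule.mem_span_singleton.2 ⟨c, hc.symm⟩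
  have hgspan : g x ∈ Submodule.span K {J x} := by
    obtain ⟨u, hu⟩ := hgx
    rw [← hu]
    exact hJspan u (apply_mem_range_of_chain_two hr hK hJS hJ hg hk hgk hu.symm)
  -- Polarization with u = 0 gives h(U) ⊆ W. Write g x = J u and h x = J v: comparing two-step
  -- chains for g and g + h leaves g v in W, whence J v lies in the line of J x.
  have hvanish : ∀ h ∈ S, h k = 0 → h x ∈ Submodule.span K {J x} := by
    intro h hh hhk
    have hhW : ∀ v, h v ∈ W := by
      intro v
      obtain ⟨f, hf, hfk⟩ := lift v
      have := apply_add_apply_mem_range hr hK hJS hJ hh hf hk (u := 0) (by simpa using hhk) hfk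
      rwa [map_zero, add_zero] at this
    obtain ⟨u, hu⟩ := hgx
    obtain ⟨v, hv⟩ := hhW x
    have e1 := apply_mem_range_of_chain_two hr hK hJS hJ hg hk hgk hu.symm
    have e2 := apply_mem_range_of_chain_two hr hK hJS hJ (S.add_mem hg hh) hk (u := x) (v := u + v)
      (by simp [hgk, hhk]) (by simp [hu, hv])
    rw [← hv]
    refine hJspan v ?_
    rw [LinearMap.add_apply, map_add, add_assoc] at e2
    have e3 := (Submodule.add_mem_iff_right _ e1).1 e2
    exact (Submodule.add_mem_iff_left _ (hhW _)).1 e3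
  have hinf : orbit S x ⊓ W ≤ Submodule.span K {J x} := by
    rintro y ⟨hy, hyW⟩
    obtain ⟨f, hf, rfl⟩ := (mem_orbit S x y).1 hy
    obtain ⟨u, hu⟩ := hD f hf k hk
    have h5 := apply_add_apply_mem_range hr hK hJS hJ hf hg hk hu.symm hgk
    obtain ⟨c, hc⟩ := hgW u ((Submodule.add_mem_iff_right _ hyW).1 h5)
    rw [map_sub, map_smul, sub_eq_zero, hu, ← hgk] at hc
    -- Since g u lies in W, f k = J u is c times J x = g k, so f - c g kills k.
    have h6 := hvanish (f - c • g) (S.sub_mem hf (S.smul_mem c hg)) (by simp [hc])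
    have h7 := Submodule.add_mem _ h6 (Submodule.smul_mem _ c hgspan)
    simpa using h7
  have h5 := (Submodule.finrank_mono hinf).trans (finrank_span_singleton_le_one _)
  have := le_choose_two_add_one r
  omega

end Restriction

/-! ### The induction on the rank -/

/-- **Bound on the transitive rank of an operator space with the column property.** -/
theorem OperatorColumnProperty.finrank_orbit_le [FiniteDimensional K U] [FiniteDimensional K V]
    {S : Submodule K (U →ₗ[K] V)} (hS : OperatorColumnProperty S) {r : ℕ}
    (hr : ∀ f ∈ S, Module.finrank K (LinearMap.range f) ≤ r)
    (hK : (r : Cardinal) < Cardinal.mk K) (x : U) :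
    Module.finrank K (orbit S x) ≤ r.choose 2 + 1 := by
  induction r using Nat.strong_induction_on generalizing V with
  | _ r ih =>
  by_cases hJ : ∃ J ∈ S, Module.finrank K (LinearMap.range J) = r
  swap
  · have hlt : ∀ f ∈ S, Module.finrank K (LinearMap.range f) < r := fun f hf =>
      lt_of_le_of_ne (hr f hf) fun h => hJ ⟨f, hf, h⟩
    have h0 := hlt 0 S.zero_mem
    refine (ih (r - 1) (by omega) hS (fun f hf => Nat.le_pred_of_lt (hlt f hf))
      ((Nat.cast_le.2 (Nat.pred_le r)).trans_lt hK)).trans ?_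
    exact Nat.add_le_add_right (Nat.choose_mono 2 (Nat.pred_le r)) 1
  obtain ⟨J, hJS, hJ⟩ := hJ
  have hsmall : orbit S x ≤ LinearMap.range J →
      Module.finrank K (orbit S x) ≤ r.choose 2 + 1 := fun h =>
    ((Submodule.finrank_mono h).trans hJ.le).trans (le_choose_two_add_one r)
  have hD : ∀ f ∈ S, ∀ v ∈ LinearMap.ker J, f v ∈ LinearMap.range J := fun f hf v hv =>
    apply_mem_range_of_mem_ker hr hK hJS hJ hf hv
  by_cases hx : J x = 0
  · refine hsmall fun y hy => ?_
    obtain ⟨f, hf, rfl⟩ := (mem_orbit S x y).1 hy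
    exact hD f hf x hx
  have hker : LinearMap.ker J ≠ ⊤ := fun h => hx (LinearMap.mem_ker.1 (h ▸ Submodule.mem_top))
  have hrank := LinearMap.finrank_range_add_finrank_ker J
  have step : ∀ (W : Submodule K V) (q : ℕ), q < r →
      (∀ f ∈ S, Module.finrank K (LinearMap.range (W.mkQ ∘ₗ f)) ≤ q) →
      Module.finrank K (orbit S x) ≤ q.choose 2 + 1 + Module.finrank K W := by
    intro W q hq hW
    refine (finrank_orbit_le_of_map_mkQ S W x).trans (Nat.add_le_add_right ?_ _)
    refine ih q hq (hS.map_mkQ W) ?_ ((Nat.cast_lt.2 hq).trans hK)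
    rintro _ ⟨f, hf, rfl⟩
    exact hW f hf
  have hlow : ∀ W : Submodule K V, (∀ f ∈ S, ∀ v ∈ LinearMap.ker J, f v ∈ W) → ∀ f ∈ S,
      Module.finrank K (LinearMap.range (W.mkQ ∘ₗ f)) ≤ r - 1 := by
    intro W hW f hf
    have := hS.finrank_range_mkQ_lt hker hW hf
    omega
  by_cases hB : ∀ f ∈ S, Module.finrank K (LinearMap.range ((LinearMap.range J).mkQ ∘ₗ f)) ≤ r - 2
  -- Induction costs dim range J = r, and C(r-2,2) + r ≤ C(r,2) only for r ≥ 3. For r ≤ 2 the ranks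
  -- modulo range J vanish.
  · by_cases hr2 : r ≤ 2
    · refine hsmall fun y hy => ?_
      obtain ⟨f, hf, rfl⟩ := (mem_orbit S x y).1 hy
      have h0 : LinearMap.range ((LinearMap.range J).mkQ ∘ₗ f) = ⊥ :=
        Submodule.finrank_eq_zero.1 (by have := hB f hf; omega)
      have := LinearMap.congr_fun (LinearMap.range_eq_bot.1 h0) x
      simpa using this
    · have := step _ (r - 2) (by omega) hB
      obtain ⟨q, rfl⟩ : ∃ q, r = q + 2 := ⟨r - 2, by omega⟩
      rw [succ_choose_two, succ_choose_two]
      rw [Nat.add_sub_cancel] at this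
      omega
  push Not at hB
  obtain ⟨g, hg, hgr⟩ := hB
  have hg1 := hlow _ hD g hg
  have hr2 : 2 ≤ r := by omega
  let W' : Submodule K V := ⨆ f ∈ S, (LinearMap.ker J).map f
  have hW' : ∀ f ∈ S, ∀ v ∈ LinearMap.ker J, f v ∈ W' := fun f hf v hv =>
    (le_iSup₂_of_le f hf le_rfl : (LinearMap.ker J).map f ≤ W') (Submodule.mem_map_of_mem hv)
  have hW'le : ∀ N : Submodule K V, (∀ f ∈ S, ∀ v ∈ LinearMap.ker J, f v ∈ N) → W' ≤ N :=
    fun N hN => iSup₂_le fun f hf => Submodule.map_le_iff_le_comap.2 fun v hv => hN f hf v hv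
  by_cases hdim : Module.finrank K W' ≤ r - 1
  · have := step W' (r - 1) (by omega) (hlow W' hW')
    obtain ⟨q, rfl⟩ : ∃ q, r = q + 1 := ⟨r - 1, by omega⟩
    rw [succ_choose_two]
    rw [Nat.add_sub_cancel] at this hdim
    omega
  have hWeq : W' = LinearMap.range J := Submodule.eq_of_le_of_finrank_le (hW'le _ hD) (by omega)
  let T := S.map (LinearMap.lcomp K V (LinearMap.ker J).subtype)
  have hT : ∀ f ∈ T, Module.finrank K (LinearMap.range f) ≤ 1 := by
    rintro _ ⟨f, hf, rfl⟩
    exact finrank_range_domRestrict_ker_le_one hr hK hJS hJ hr2 hg (by omega) hf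
  rcases exists_common_line_or_common_vector T hT with ⟨w, hw⟩ | ⟨k, hk⟩
  · have h1 : W' ≤ Submodule.span K {w} := hW'le _ fun f hf v hv =>
      hw _ (Submodule.mem_map_of_mem hf) ⟨v, hv⟩
    have := (Submodule.finrank_mono h1).trans (finrank_span_singleton_le_one _)
    omega
  · refine finrank_orbit_le_of_range_le_orbit hr hK hJS hJ hr2 (hlow _ hD) k.2 ?_ hx
    rw [← hWeq]
    refine hW'le _ fun f hf v hv => ?_
    have h1 : f v ∈ Submodule.span K {f k} := hk _ (Submodule.mem_map_of_mem hf) ⟨v, hv⟩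
    exact (Submodule.span_singleton_le_iff_mem _ _).2 ((mem_orbit S _ _).2 ⟨f, hf, rfl⟩) h1

end Structure

end LLD
namespace LLD

/-! ### Duality and minimal LLD spaces -/

section Duality

variable {K : Type*} [Field K] {U V : Type*} [AddCommGroup U] [Module K U]
  [AddCommGroup V] [Module K V]

/-- The dual operator space of `S`, consisting of the evaluations `f ↦ f x` on `S`. -/
def dualOperatorSpace (S : Submodule K (U →ₗ[K] V)) : Submodule K (S →ₗ[K] V) :=
  LinearMap.range S.subtype.flip

theorem orbit_dualOperatorSpace (S : Submodule K (U →ₗ[K] V)) (f : S) :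
    orbit (dualOperatorSpace S) f = LinearMap.range (f : U →ₗ[K] V) := by
  ext y
  simp [mem_orbit, dualOperatorSpace]

theorem IsLLD.finrank_range_flip_lt {S : Submodule K (U →ₗ[K] V)} [FiniteDimensional K S]
    (hS : IsLLD S) (x : U) :
    Module.finrank K (LinearMap.range (S.subtype.flip x)) < Module.finrank K S := by
  obtain ⟨f, hf, hf0, hfx⟩ := hS x
  have h1 : 0 < Module.finrank K (LinearMap.ker (S.subtype.flip x)) := by
    rw [Nat.pos_iff_ne_zero, Ne, Submodule.finrank_eq_zero]
    intro h
    have : (⟨f, hf⟩ : S) ∈ LinearMap.ker (S.subtype.flip x) := by simpa using hfx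
    rw [h] at this
    exact hf0 (congrArg Subtype.val ((Submodule.mem_bot K).1 this))
  have := LinearMap.finrank_range_add_finrank_ker (S.subtype.flip x)
  omega

/-- If some `φ x` is injective modulo `U₀` and `W`, and some `φ y` is injective on `U₀`, then some
`φ z` is injective. -/
theorem exists_injective_of_injective_mod {E : Type*} [AddCommGroup E] [Module K E]
    [FiniteDimensional K E] [FiniteDimensional K V] (φ : U →ₗ[K] E →ₗ[K] V) {U₀ : Submodule K E}
    {W : Submodule K V} (h : ∀ u, ∀ f ∈ U₀, φ u f ∈ W) {x y : U} (hx : ∀ f, φ x f ∈ W → f ∈ U₀)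
    (hy : ∀ f ∈ U₀, φ y f = 0 → f = 0)
    (hK : (Module.finrank K E : Cardinal) ≤ Cardinal.mk K) :
    ∃ z, ∀ f, φ z f = 0 → f = 0 := by
  have hxker : LinearMap.ker (W.mkQ ∘ₗ φ x) ≤ U₀ := fun f hf => hx f (by simpa using hf)
  have hyker : LinearMap.ker (φ y ∘ₗ U₀.subtype) = ⊥ :=
    (Submodule.eq_bot_iff _).2 fun f hf => Subtype.ext (hy f f.2 hf)
  have e1 := LinearMap.finrank_range_add_finrank_ker (W.mkQ ∘ₗ φ x)
  have e2 := LinearMap.finrank_range_add_finrank_ker (φ y ∘ₗ U₀.subtype)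
  have e3 := Submodule.finrank_mono hxker
  have e4 := Submodule.finrank_le U₀
  rw [hyker, finrank_bot, add_zero] at e2
  obtain ⟨s, t, hs, ht⟩ := exists_combination_of_le_finrank
    (a := Module.finrank K E - Module.finrank K U₀) (f := W.mkQ ∘ₗ φ x) (f' := W.mkQ ∘ₗ φ y)
    (g := φ x ∘ₗ U₀.subtype) (by omega) e2.ge
    (by rwa [Nat.sub_add_cancel e4])
  have c1 : s • W.mkQ ∘ₗ φ x + t • W.mkQ ∘ₗ φ y = W.mkQ ∘ₗ φ (s • x + t • y) := by
    ext f
    simp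
  have c2 : s • φ x ∘ₗ U₀.subtype + t • φ y ∘ₗ U₀.subtype = φ (s • x + t • y) ∘ₗ U₀.subtype := by
    ext f
    simp
  rw [c1] at hs
  rw [c2] at ht
  have e5 := LinearMap.finrank_range_add_finrank_ker (W.mkQ ∘ₗ φ (s • x + t • y))
  have e6 := LinearMap.finrank_range_add_finrank_ker (φ (s • x + t • y) ∘ₗ U₀.subtype)
  have hker : U₀ = LinearMap.ker (W.mkQ ∘ₗ φ (s • x + t • y)) :=
    Submodule.eq_of_le_of_finrank_le (fun f hf => by
      rw [LinearMap.mem_ker, LinearMap.comp_apply, Submodule.mkQ_apply,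
        Submodule.Quotient.mk_eq_zero]
      exact h _ f hf) (by omega)
  have hker' : LinearMap.ker (φ (s • x + t • y) ∘ₗ U₀.subtype) = ⊥ :=
    Submodule.finrank_eq_zero.1 (by omega)
  refine ⟨s • x + t • y, fun f hf => ?_⟩
  have hfU : f ∈ U₀ := by
    rw [hker, LinearMap.mem_ker, LinearMap.comp_apply, hf, map_zero]
  have hfk : (⟨f, hfU⟩ : U₀) ∈ LinearMap.ker (φ (s • x + t • y) ∘ₗ U₀.subtype) := hf
  rw [hker', Submodule.mem_bot] at hfk
  exact congrArg Subtype.val hfk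

/-- By minimality a proper subspace U₀ of S is not LLD, so some evaluation is injective on U₀. If
another were injective modulo U₀ and W, a combination would be injective on S, contradicting LLD. -/
theorem operatorColumnProperty_dualOperatorSpace [FiniteDimensional K V]
    {S : Submodule K (U →ₗ[K] V)} [FiniteDimensional K S] (hS : Minimal IsLLD S)
    (hK : (Module.finrank K S : Cardinal) ≤ Cardinal.mk K) :
    OperatorColumnProperty (dualOperatorSpace S) := by
  rintro U₀ W hU₀ h _ ⟨x, rfl⟩
  by_contra! hcon
  have hnot : ¬ IsLLD (U₀.map S.subtype) := by
    intro hl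
    refine hU₀ (eq_top_iff.2 fun f _ => ?_)
    obtain ⟨g, hg, hgf⟩ := hS.2 hl (Submodule.map_subtype_le S U₀) f.2
    rwa [← Subtype.val_injective hgf]
  obtain ⟨y, hy⟩ := not_forall.1 hnot
  push Not at hy
  obtain ⟨z, hz⟩ := exists_injective_of_injective_mod S.subtype.flip
    (fun u f hf => h _ ⟨u, rfl⟩ f hf) (fun f hf => by_contra fun hfU => hcon f hfU hf)
    (y := y) (fun f hf hf0 => by_contra fun hne =>
      hy f (Submodule.mem_map_of_mem hf) (fun h0 => hne (Subtype.ext h0)) hf0) hK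
  obtain ⟨f, hf, hf0, hfz⟩ := hS.1 z
  exact hf0 (congrArg Subtype.val (hz ⟨f, hf⟩ hfz))

end Duality

/-! ### From matrices to operators -/

section Coordinates

variable {K : Type*} [Field K]

theorem exists_linearEquiv_mem_iff {E : Type*} [AddCommGroup E] [Module K E]
    [FiniteDimensional K E] {N N' : Submodule K E} (h : Module.finrank K N = Module.finrank K N') :
    ∃ L : E ≃ₗ[K] E, ∀ x, L x ∈ N' ↔ x ∈ N := by
  obtain ⟨L, hL⟩ := Submodule.exists_linearEquiv_restrict_eq (LinearEquiv.ofFinrankEq N N' h)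
  have hle : N.map L.toLinearMap ≤ N' := by
    rintro _ ⟨x, hx, rfl⟩
    have h1 : L x = LinearEquiv.ofFinrankEq N N' h ⟨x, hx⟩ := (hL ⟨x, hx⟩).symm
    rw [LinearEquiv.coe_coe, h1]
    exact Subtype.property _
  have heq : N.map L.toLinearMap = N' :=
    Submodule.eq_of_le_of_finrank_le hle (by rw [LinearEquiv.finrank_map_eq, h])
  refine ⟨L, fun x => ?_⟩
  rw [← heq]
  exact L.injective.mem_set_image (s := (N : Set E))

theorem exists_linearEquiv_mem_iff_apply_eq_zero {n : ℕ} (N : Submodule K (Fin n → K))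
    (t : Finset (Fin n)) (ht : t.card = Module.finrank K N) :
    ∃ L : (Fin n → K) ≃ₗ[K] (Fin n → K), ∀ x, L x ∈ N ↔ ∀ i ∉ t, x i = 0 := by
  have hf : Module.finrank K (⨅ i ∈ (↑t : Set (Fin n))ᶜ,
      LinearMap.ker (LinearMap.proj i : (Fin n → K) →ₗ[K] K) : Submodule K (Fin n → K)) =
      Module.finrank K N := by
    rw [(LinearMap.iInfKerProjEquiv K (fun _ => K) (I := (↑t : Set (Fin n)))
      (J := (↑t : Set (Fin n))ᶜ) disjoint_compl_right (by simp)).finrank_eq]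
    simpa using ht
  obtain ⟨L, hL⟩ := exists_linearEquiv_mem_iff hf
  refine ⟨L, fun x => (hL x).trans ?_⟩
  simp [Submodule.mem_iInf]

/-- The invertible matrix of a linear automorphism of coordinate space. -/
noncomputable def matrixUnit {n : ℕ} (L : (Fin n → K) ≃ₗ[K] (Fin n → K)) : GL (Fin n) K where
  val := LinearMap.toMatrix' L.toLinearMap
  inv := LinearMap.toMatrix' L.symm.toLinearMap
  val_inv := by rw [← LinearMap.toMatrix'_comp]; simp
  inv_val := by rw [← LinearMap.toMatrix'_comp]; simp

theorem matrixUnit_mulVec {n : ℕ} (L : (Fin n → K) ≃ₗ[K] (Fin n → K)) (x : Fin n → K) :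
    Matrix.mulVec (matrixUnit L : Matrix (Fin n) (Fin n) K) x = L x :=
  LinearMap.toMatrix'_mulVec L.toLinearMap x

variable {m n : ℕ}

/-- The linear map `M ↦ P M Q`. -/
def mulLeftRight (P : Matrix (Fin m) (Fin m) K) (Q : Matrix (Fin n) (Fin n) K) :
    Matrix (Fin m) (Fin n) K →ₗ[K] Matrix (Fin m) (Fin n) K where
  toFun M := P * M * Q
  map_add' M N := by rw [Matrix.mul_add, Matrix.add_mul]
  map_smul' c M := by simp

theorem ColumnProperty.operatorColumnProperty {S : Submodule K (Matrix (Fin m) (Fin n) K)}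
    (hS : ColumnProperty S) : OperatorColumnProperty (toOperatorSpace S) := by
  rintro U₀ W hU₀ h _ ⟨M, hM, rfl⟩
  have hd : Module.finrank K U₀ < n := by simpa using Submodule.finrank_lt hU₀
  have hp : Module.finrank K W ≤ m := by simpa using Submodule.finrank_le W
  set p := Module.finrank K W
  obtain ⟨s, hs⟩ : ∃ s, s = n - Module.finrank K U₀ := ⟨_, rfl⟩
  have hsn : s ≤ n := by omega
  -- Adapted coordinates: U₀ becomes the span of the last n - s basis vectors and W that of the
  -- first p, so the vanishing block expresses f(U₀) ⊆ W.
  obtain ⟨Q, hQ⟩ := exists_linearEquiv_mem_iff_apply_eq_zero U₀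
    (Finset.univ.filter fun i : Fin n => s ≤ i) (by
      have h1 := Finset.card_filter_add_card_filter_not (s := Finset.univ)
        fun i : Fin n => (i : ℕ) < s
      rw [Fin.card_filter_val_lt, Finset.card_univ, Fintype.card_fin] at h1
      simp only [not_lt] at h1
      omega)
  obtain ⟨P, hP⟩ := exists_linearEquiv_mem_iff_apply_eq_zero W
    (Finset.univ.filter fun i : Fin m => (i : ℕ) < p) (by
      rw [Fin.card_filter_val_lt]
      omega)
  simp only [Finset.mem_filter, Finset.mem_univ, true_and, not_le, not_lt] at hQ hP
  let S' := S.map (mulLeftRight (matrixUnit P.symm : Matrix (Fin m) (Fin m) K)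
    (matrixUnit Q : Matrix (Fin n) (Fin n) K))
  have hmul : ∀ (N : Matrix (Fin m) (Fin n) K) (x : Fin n → K),
      Matrix.mulVec (mulLeftRight (matrixUnit P.symm : Matrix (Fin m) (Fin m) K)
        (matrixUnit Q : Matrix (Fin n) (Fin n) K) N) x = P.symm (Matrix.mulVec N (Q x)) := by
    intro N x
    rw [← matrixUnit_mulVec P.symm, ← matrixUnit_mulVec Q, Matrix.mulVec_mulVec,
      Matrix.mulVec_mulVec]
    rfl
  have hPW : ∀ y, (∀ i : Fin m, p ≤ i → P.symm y i = 0) ↔ y ∈ W := by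
    intro y
    rw [← hP, LinearEquiv.apply_symm_apply]
  have hdec : IsDecomposed p s S' := by
    rintro _ ⟨N, hN, rfl⟩ i j hi hj
    have h1 : Q (Pi.single j 1) ∈ U₀ := (hQ _).2 fun i hi => by
      rw [Pi.single_eq_of_ne]
      rintro rfl
      omega
    have h2 := (hPW _).2 (h _ (Submodule.mem_map_of_mem hN) _ h1) i hi
    have h3 : P.symm (Matrix.mulVec N (Q (Pi.single j 1))) i = 0 := h2
    rwa [← hmul, Matrix.mulVec_single_one] at h3
  have hnot := hS p s hp (by omega) hsn S' ⟨matrixUnit P.symm, matrixUnit Q, rfl⟩ hdec _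
    (Submodule.mem_map_of_mem (Submodule.mem_map_of_mem (Submodule.mem_map_of_mem hM)))
  rw [← LinearMap.ker_eq_bot, Submodule.eq_bot_iff] at hnot
  push Not at hnot
  obtain ⟨y, hy, hy0⟩ := hnot
  -- Padding a kernel vector of the lower block by zeros gives a vector outside U₀ sent into W.
  let z : Fin n → K := fun j => if hj : (j : ℕ) < s then y ⟨j, hj⟩ else 0
  refine ⟨Q z, fun hz => hy0 ?_, ?_⟩
  · ext j
    have := (hQ z).1 hz (Fin.castLE hsn j) j.2
    simpa [z] using this
  · refine (hPW _).1 fun i hi => ?_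
    change P.symm (Matrix.mulVec M (Q z)) i = 0
    rw [← hmul]
    have h1 : Matrix.mulVec (lowerBlock p s hsn (mulLeftRight
      (matrixUnit P.symm : Matrix (Fin m) (Fin m) K)
      (matrixUnit Q : Matrix (Fin n) (Fin n) K) M)) y ⟨i - p, by omega⟩ = 0 := congrFun hy _
    rw [← h1]
    refine (Fintype.sum_of_injective (Fin.castLE hsn) (Fin.castLE_injective hsn) _ _ ?_ ?_).symm
    · intro j hj
      have : ¬ (j : ℕ) < s := fun hjs => hj ⟨⟨j, hjs⟩, rfl⟩
      simp [z, this]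
    · intro j
      have h2 : (⟨p + (i - p), by omega⟩ : Fin m) = i := Fin.ext (Nat.add_sub_cancel' hi)
      have h3 : ∀ N : Matrix (Fin m) (Fin n) K,
          lowerBlock p s hsn N ⟨i - p, by omega⟩ j = N i (Fin.castLE hsn j) := fun N =>
        congrArg (fun k => N k (Fin.castLE hsn j)) h2
      simp [z, h3]

end Coordinates

end LLD

theorem mainTheorem8 {K : Type*} [Field K] :
    (∀ (m n : ℕ) (S : Submodule K (Matrix (Fin m) (Fin n) K)),
      LLD.IsReduced (LLD.toOperatorSpace S) →
      LLD.ColumnProperty S →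
      (LLD.upperRank (LLD.toOperatorSpace S) : Cardinal) < Cardinal.mk K →
      LLD.transitiveRank (LLD.toOperatorSpace S) ≤
        (LLD.upperRank (LLD.toOperatorSpace S)).choose 2 + 1) ∧
    (∀ (U V : Type*) [AddCommGroup U] [Module K U] [FiniteDimensional K U]
      [AddCommGroup V] [Module K V] [FiniteDimensional K V]
      (n : ℕ) (S : Submodule K (U →ₗ[K] V)),
      Minimal LLD.IsLLD S →
      Module.finrank K S = n →
      (n : Cardinal) ≤ Cardinal.mk K →
      ∀ f ∈ S, Module.finrank K (LinearMap.range f) ≤ 1 + (n - 1).choose 2) := by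
  refine ⟨fun m n S _ hS hK => ?_, ?_⟩
  · obtain ⟨x, hx⟩ := (LLD.exists_finrank_orbit_eq_transitiveRank (LLD.toOperatorSpace S)).1
    rw [← hx]
    exact hS.operatorColumnProperty.finrank_orbit_le
      (LLD.exists_finrank_range_eq_upperRank (LLD.toOperatorSpace S)).2 hK x
  · rintro U V _ _ _ _ _ _ n S hS rfl hK f hf
    have hrank := hS.1.finrank_range_flip_lt
    have hpos := hrank 0
    have hlt : ((Module.finrank K S - 1 : ℕ) : Cardinal) < Cardinal.mk K :=
      (Nat.cast_lt.2 (by omega)).trans_le hK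
    have := (LLD.operatorColumnProperty_dualOperatorSpace hS hK).finrank_orbit_le
      (r := Module.finrank K S - 1)
      (by rintro _ ⟨x, rfl⟩; exact Nat.le_pred_of_lt (hrank x)) hlt ⟨f, hf⟩
    rwa [LLD.orbit_dualOperatorSpace, add_comm] at this
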